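/- Let $K$ be a field with $\operatorname{char}(K)\neq 2$, let $e_1,\dots,e_4$ be the standard basis of $K^4$, and let \[ \det\nolimits_4=\sum_{\sigma\in\mathfrak S_4}\operatorname{sgn}(\sigma)\,e_{\sigma(1)}\otimes e_{\sigma(2)}\otimes e_{\sigma(3)}\otimes e_{\sigma(4)}\in (K^4)^{\otimes 4} \] be the determinant tensor. For $T\in (K^4)^{\otimes 4}$, let the tensor rank $\mathbf R(T)$ be the smallest $k\ge 0$ such that $T=\sum_{i=1}^k v_{i,1}\otimes v_{i,2}\otimes v_{i,3}\otimes v_{i,4}$ for some vectors $v_{i,j}\in K^4$. Then \[ \mathbf R(\det\nolimits_4)=12 . \] -/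

import Mathlib

open scoped TensorProduct

/-- The tensor rank of `T ∈ ⨂ j, V j`: the least `k` such that `T` is a sum of `k` decomposable
tensors `v₁ ⊗ ⋯ ⊗ v_d`. -/
noncomputable def tensorRank {ι : Type*} (K : Type*) [Field K] {V : ι → Type*}
    [∀ j, AddCommGroup (V j)] [∀ j, Module K (V j)] (T : ⨂[K] j, V j) : ℕ :=
  sInf {k : ℕ | ∃ v : Fin k → (j : ι) → V j, T = ∑ i, PiTensorProduct.tprod K (v i)}

/-- The determinant tensor `∑ σ, sgn σ • e_{σ(1)} ⊗ ⋯ ⊗ e_{σ(n)}` in `(Kⁿ)^{⊗ n}`, where `e` is the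
standard basis of `Kⁿ`. -/
noncomputable def detTensor (K : Type*) [Field K] (n : ℕ) : ⨂[K] _ : Fin n, (Fin n → K) :=
  ∑ σ : Equiv.Perm (Fin n), ((Equiv.Perm.sign σ : ℤ) : K) •
    PiTensorProduct.tprod K (fun j : Fin n => (Pi.single (σ j) (1 : K) : Fin n → K))

open Module

/-! Lower bound: write a decomposition as `∑ i, a i ⊗ b i ⊗ c i ⊗ d i` and regard coefficients as
functions of `i` in `K ^ k`. Antisymmetry makes `symSpan a b` orthogonal to every product of
coordinates of `c` and `d`. These products span a space containing `symSpan c d ⊕ altSpan c d`. As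
`altSpan a b` and `altSpan c d` are paired by 4 times the Levi-Civita symbol, perfectly when `2 ≠
0`, the sum is direct and `altSpan c d` has dimension 6. Hence `k ≥ dim symSpan a b + dim symSpan c
d + 6`.

Each symmetric span has dimension at least 3: `altSpan * altSpan ≤ symSpan * symSpan`, where the
left side has dimension at least 6 and the right at most 3 if `dim symSpan ≤ 2`. So `k ≥ 12`.

Upper bound: in the Laplace expansion along pairs of slots, each of the six terms `W ⊗ W'` is half
of `(S + W) ⊗ (S' + W') + (S - W) ⊗ (S' - W')`, up to the error `S ⊗ S'`; the signed errors cancel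
by a Plücker-type identity. -/

/-- The Levi-Civita symbol on four indices. -/
def leviCivita (p q s t : Fin 4) : ℤ :=
  ((q : ℤ) - p).sign * ((s : ℤ) - p).sign * ((t : ℤ) - p).sign * ((s : ℤ) - q).sign *
    ((t : ℤ) - q).sign * ((t : ℤ) - s).sign

theorem leviCivita_swap_left (p q s t : Fin 4) :
    leviCivita q p s t = -leviCivita p q s t := by
  revert p q s t; decide

theorem leviCivita_swap_right (p q s t : Fin 4) :
    leviCivita p q t s = -leviCivita p q s t := by
  revert p q s t; decide

theorem leviCivita_swap_pairs (p q s t : Fin 4) :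
    leviCivita s t p q = leviCivita p q s t := by
  revert p q s t; decide

set_option maxRecDepth 100000 in
theorem sum_perm_sign_eq_leviCivita (p q s t : Fin 4) :
    ∑ σ : Equiv.Perm (Fin 4), (Equiv.Perm.sign σ : ℤ) *
      (if σ 0 = p ∧ σ 1 = q ∧ σ 2 = s ∧ σ 3 = t then 1 else 0) = leviCivita p q s t := by
  revert p q s t; decide +kernel

/-- The two-element subsets of `Fin 4`, listed so that `pair x` and `pair x.rev` are
complementary. -/
def pair : Fin 6 → Fin 4 × Fin 4 := ![(0, 1), (0, 2), (0, 3), (1, 2), (1, 3), (2, 3)]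

/-- The sign of the shuffle given by `pair x` and its complement. -/
def pairSign : Fin 6 → ℤ := ![1, -1, 1, 1, -1, 1]

theorem leviCivita_pair (x y : Fin 6) :
    leviCivita (pair x).1 (pair x).2 (pair y).1 (pair y).2 =
      if x = y.rev then pairSign x else 0 := by
  revert x y; decide

theorem pairSign_mul_self (x : Fin 6) : pairSign x * pairSign x = 1 := by
  revert x; decide

/-! ### Dimensions of products of subspaces -/

/-- Pointwise multiplication does not lower the dimension of a space of functions. -/
theorem finrank_le_finrank_mul_self {K ι : Type*} [Field K] [Fintype ι]
    (U : Submodule K (ι → K)) : finrank K U ≤ finrank K ↥(U * U) := by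
  classical
  let φ : ι → Dual K U := fun i => (LinearMap.proj i).comp U.subtype
  obtain ⟨κ, a, ha, hspan, hli⟩ := exists_linearIndependent' K φ
  have : Finite κ := Finite.of_injective a ha
  have := Fintype.ofFinite κ
  let L : U →ₗ[K] (κ → K) := LinearMap.pi fun k => φ (a k)
  have hL : Function.Injective L := by
    rw [← LinearMap.ker_eq_bot, LinearMap.ker_eq_bot']
    intro u hu
    have hker : Submodule.span K (Set.range φ) ≤ LinearMap.ker (Dual.eval K U u) := by
      rw [← hspan, Submodule.span_le]
      rintro _ ⟨k, rfl⟩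
      exact congrFun hu k
    ext i
    exact hker (Submodule.subset_span ⟨i, rfl⟩)
  have hcard : Fintype.card κ ≤ finrank K U := by
    simpa [Subspace.dual_finrank_eq] using hli.fintype_card_le_finrank
  have hle : finrank K U ≤ Fintype.card κ := by
    simpa using LinearMap.finrank_le_finrank_of_injective hL
  have hsurj : Function.Surjective L :=
    (LinearMap.injective_iff_surjective_of_finrank_eq_finrank
      (by simpa using le_antisymm hle hcard)).1 hL
  -- On the coordinates chosen by `a`, the `v k` restrict to the standard basis, which consists of
  -- idempotents; so the squares restrict to it too.
  choose v hv using fun k : κ => hsurj (Pi.single k 1)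
  let w : κ → ↥(U * U) := fun k => ⟨v k * v k, Submodule.mul_mem_mul (v k).2 (v k).2⟩
  have hw : LinearIndependent K w := by
    refine LinearIndependent.of_comp ((LinearMap.funLeft K K a).comp (U * U).subtype) ?_
    convert (Pi.basisFun K κ).linearIndependent using 1
    ext k l
    have h : (v k : ι → K) (a l) = (Pi.single k 1 : κ → K) l := congrFun (hv k) l
    by_cases hkl : l = k
    · subst hkl; simp [w, LinearMap.funLeft_apply, h]
    · simp [w, LinearMap.funLeft_apply, h, hkl]
  exact hle.trans hw.fintype_card_le_finrank

open scoped Pointwise in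
/-- The products of a space of dimension at most two span a space of dimension at most three. -/
theorem finrank_mul_self_le_three {K A : Type*} [Field K] [CommRing A] [Algebra K A]
    (F : Submodule K A) [FiniteDimensional K F] (hF : finrank K F ≤ 2) :
    finrank K ↥(F * F) ≤ 3 := by
  classical
  obtain ⟨x, y, rfl⟩ : ∃ x y : A, F = Submodule.span K {x, y} := by
    obtain ⟨g, hg⟩ : ∃ g : Fin 2 → F, Submodule.span K (Set.range g) = ⊤ := by
      let b := finBasis K F
      -- Padding with zero gives two generators even when the dimension is below 2.
      refine ⟨fun i => if h : (i : ℕ) < finrank K F then b ⟨i, h⟩ else 0, ?_⟩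
      rw [eq_top_iff, ← b.span_eq, Submodule.span_le]
      rintro _ ⟨i, rfl⟩
      exact Submodule.subset_span ⟨⟨i, i.2.trans_le hF⟩, by simp⟩
    refine ⟨g 0, g 1, ?_⟩
    have h := congrArg (Submodule.map F.subtype) hg
    rw [Submodule.map_span, Submodule.map_top, Submodule.range_subtype, ← Set.range_comp] at h
    refine h.symm.trans (congrArg _ ?_)
    ext z
    simp [Fin.exists_fin_two, eq_comm]
  rw [Submodule.span_mul_span]
  have hsub : ({x, y} * {x, y} : Set A) ⊆ (({x * x, x * y, y * y} : Finset A) : Set A) := by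
    rintro _ ⟨u, hu, v, hv, rfl⟩
    rcases hu with rfl | rfl <;> rcases hv with rfl | rfl <;> simp [mul_comm]
  calc _ ≤ finrank K (Submodule.span K (({x * x, x * y, y * y} : Finset A) : Set A)) :=
        Submodule.finrank_mono (Submodule.span_mono hsub)
    _ ≤ _ := finrank_span_finset_le_card _
    _ ≤ 3 := Finset.card_le_three

section LowerBound

variable {K : Type*} [Field K] {k : ℕ}

/-- The function `i ↦ a i p * b i q + a i q * b i p`, a coefficient of the quadratic form
`a i * b i`. -/
def symCoeff (a b : Fin k → Fin 4 → K) (x : Fin 4 × Fin 4) : Fin k → K :=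
  fun i => a i x.1 * b i x.2 + a i x.2 * b i x.1

/-- The function `i ↦ a i p * b i q - a i q * b i p`, a coefficient of the bivector
`a i ∧ b i`. -/
def altCoeff (a b : Fin k → Fin 4 → K) (x : Fin 4 × Fin 4) : Fin k → K :=
  fun i => a i x.1 * b i x.2 - a i x.2 * b i x.1

/-- The span of the functions `symCoeff a b`. -/
def symSpan (a b : Fin k → Fin 4 → K) : Submodule K (Fin k → K) :=
  Submodule.span K (Set.range (symCoeff a b))

/-- The span of the functions `altCoeff a b`. -/
def altSpan (a b : Fin k → Fin 4 → K) : Submodule K (Fin k → K) :=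
  Submodule.span K (Set.range fun x : Fin 6 => altCoeff a b (pair x))

/-- The tensor `∑ i, a i ⊗ b i ⊗ c i ⊗ d i` has the coordinates of the determinant tensor. -/
def IsDetDecomposition (a b c d : Fin k → Fin 4 → K) : Prop :=
  ∀ p q s t, ∑ i, a i p * b i q * c i s * d i t = (leviCivita p q s t : K)

variable {a b c d : Fin k → Fin 4 → K}

theorem IsDetDecomposition.swap (h : IsDetDecomposition a b c d) :
    IsDetDecomposition c d a b := by
  intro p q s t
  rw [← leviCivita_swap_pairs, ← h]
  exact Finset.sum_congr rfl fun i _ => by ring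

theorem IsDetDecomposition.sum_symCoeff_mul (h : IsDetDecomposition a b c d)
    (x : Fin 4 × Fin 4) (s t : Fin 4) :
    ∑ i, symCoeff a b x i * (c i s * d i t) = 0 := by
  have h1 := h x.1 x.2 s t
  have h2 := h x.2 x.1 s t
  rw [leviCivita_swap_left, Int.cast_neg, ← h1] at h2
  rw [← add_eq_zero_iff_neg_eq'.2 h2.symm, ← Finset.sum_add_distrib]
  exact Finset.sum_congr rfl fun i _ => by simp only [symCoeff]; ring

theorem IsDetDecomposition.symCoeff_dotProduct_altCoeff (h : IsDetDecomposition a b c d)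
    (x y : Fin 4 × Fin 4) : symCoeff a b x ⬝ᵥ altCoeff c d y = 0 := by
  have h1 := h.sum_symCoeff_mul x y.1 y.2
  have h2 := h.sum_symCoeff_mul x y.2 y.1
  rw [← sub_eq_zero.2 (h1.trans h2.symm), ← Finset.sum_sub_distrib]
  exact Finset.sum_congr rfl fun i _ => by simp only [altCoeff]; ring

theorem IsDetDecomposition.altCoeff_dotProduct_altCoeff (h : IsDetDecomposition a b c d)
    (x y : Fin 4 × Fin 4) :
    altCoeff a b x ⬝ᵥ altCoeff c d y = 4 * (leviCivita x.1 x.2 y.1 y.2 : K) := by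
  have h1 := h x.1 x.2 y.1 y.2
  have h2 := h x.2 x.1 y.1 y.2
  have h3 := h x.1 x.2 y.2 y.1
  have h4 := h x.2 x.1 y.2 y.1
  rw [leviCivita_swap_right, leviCivita_swap_left] at h4
  rw [leviCivita_swap_left] at h2
  rw [leviCivita_swap_right] at h3
  push_cast at h1 h2 h3 h4
  have key : altCoeff a b x ⬝ᵥ altCoeff c d y =
      ∑ i, a i x.1 * b i x.2 * c i y.1 * d i y.2 - ∑ i, a i x.2 * b i x.1 * c i y.1 * d i y.2 -
      ∑ i, a i x.1 * b i x.2 * c i y.2 * d i y.1 +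
      ∑ i, a i x.2 * b i x.1 * c i y.2 * d i y.1 := by
    simp only [← Finset.sum_sub_distrib, ← Finset.sum_add_distrib]
    exact Finset.sum_congr rfl fun i _ => by simp only [altCoeff]; ring
  rw [key, h1, h2, h3, h4]
  ring

/-- A combination of the bivector functions of `c, d` that is orthogonal to those of `a, b`
is trivial. -/
theorem IsDetDecomposition.eq_zero_of_orthogonal (h : IsDetDecomposition a b c d)
    (h2 : (2 : K) ≠ 0) (l : Fin 6 → K)
    (hl : ∀ x, altCoeff a b (pair x) ⬝ᵥ ∑ y, l y • altCoeff c d (pair y) = 0) : l = 0 := by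
  funext y
  have hy := hl y.rev
  simp only [dotProduct_sum, dotProduct_smul, h.altCoeff_dotProduct_altCoeff, leviCivita_pair,
    smul_eq_mul] at hy
  rw [Finset.sum_eq_single y (fun z _ hz => by simp [Fin.rev_inj, hz.symm]) (by simp)] at hy
  have hs : (pairSign y.rev : K) ≠ 0 := fun h0 => by
    have := congrArg (Int.cast (R := K)) (pairSign_mul_self y.rev)
    simp [h0] at this
  have h4 : (4 : K) ≠ 0 := by
    rw [show (4 : K) = 2 * 2 by norm_num]; exact mul_ne_zero h2 h2
  simpa [hs, h4] using hy

theorem IsDetDecomposition.linearIndependent_altCoeff (h : IsDetDecomposition a b c d)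
    (h2 : (2 : K) ≠ 0) : LinearIndependent K fun x : Fin 6 => altCoeff c d (pair x) := by
  rw [Fintype.linearIndependent_iff]
  intro l hl x
  exact congrFun (h.eq_zero_of_orthogonal h2 l fun y => by rw [hl, dotProduct_zero]) x

theorem IsDetDecomposition.finrank_altSpan (h : IsDetDecomposition a b c d)
    (h2 : (2 : K) ≠ 0) : finrank K (altSpan c d) = 6 :=
  (finrank_span_eq_card (h.linearIndependent_altCoeff h2)).trans (Fintype.card_fin 6)

/-- A common element is orthogonal to `altSpan a b` because it is symmetric, hence zero because the
pairing of the two alternating spans is nondegenerate. -/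
theorem IsDetDecomposition.disjoint_symSpan_altSpan (h : IsDetDecomposition a b c d)
    (h2 : (2 : K) ≠ 0) : Disjoint (symSpan c d) (altSpan c d) := by
  rw [Submodule.disjoint_def]
  intro v hv hv'
  have hort (x : Fin 6) : altCoeff a b (pair x) ⬝ᵥ v = 0 := by
    clear hv'
    induction hv using Submodule.span_induction with
    | mem w hw =>
      obtain ⟨y, rfl⟩ := hw
      rw [dotProduct_comm, h.swap.symCoeff_dotProduct_altCoeff]
    | zero => simp
    | add v w _ _ hv hw => rw [dotProduct_add, hv, hw, add_zero]
    | smul r v _ hv => rw [dotProduct_smul, hv, smul_zero]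
  obtain ⟨l, rfl⟩ := (Submodule.mem_span_range_iff_exists_fun K).1 hv'
  simp [h.eq_zero_of_orthogonal h2 l hort]

theorem IsDetDecomposition.finrank_symSpan_add_le (h : IsDetDecomposition a b c d)
    (h2 : (2 : K) ≠ 0) : finrank K (symSpan a b) + (finrank K (symSpan c d) + 6) ≤ k := by
  -- `A * B = 0` expresses the orthogonality, so the two ranks add up to at most `k`.
  let A : Matrix (Fin 4 × Fin 4) (Fin k) K := Matrix.of (symCoeff a b)
  let B : Matrix (Fin k) (Fin 4 × Fin 4) K := Matrix.of fun i x => c i x.1 * d i x.2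
  have hAB : A * B = 0 := by
    ext x y
    exact h.sum_symCoeff_mul x y.1 y.2
  have hrank := Matrix.rank_add_rank_le_card_of_mul_eq_zero hAB
  rw [Matrix.rank_eq_finrank_span_row, Matrix.rank_eq_finrank_span_cols, Fintype.card_fin]
    at hrank
  have hmem (x : Fin 4 × Fin 4) : (fun i => c i x.1 * d i x.2) ∈
      Submodule.span K (Set.range B.col) := Submodule.subset_span ⟨x, rfl⟩
  have hsup : symSpan c d ⊔ altSpan c d ≤ Submodule.span K (Set.range B.col) := by
    refine sup_le ?_ ?_ <;> refine Submodule.span_le.2 ?_ <;> rintro _ ⟨x, rfl⟩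
    · exact Submodule.add_mem _ (hmem x) (hmem x.swap)
    · exact Submodule.sub_mem _ (hmem (pair x)) (hmem (pair x).swap)
  have hdim := Submodule.finrank_sup_add_finrank_inf_eq (symSpan c d) (altSpan c d)
  rw [(h.disjoint_symSpan_altSpan h2).eq_bot, finrank_bot, h.finrank_altSpan h2, add_zero] at hdim
  rw [← hdim]
  exact (Nat.add_le_add_left (Submodule.finrank_mono hsup) _).trans hrank

/-- The `2 × 2` minors of the quadratic form `a i * b i` are products of coefficients of
`a i ∧ b i`. -/
theorem altSpan_mul_altSpan_le (a b : Fin k → Fin 4 → K) :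
    altSpan a b * altSpan a b ≤ symSpan a b * symSpan a b := by
  rw [altSpan, Submodule.span_mul_span, Submodule.span_le]
  rintro _ ⟨_, ⟨x, rfl⟩, _, ⟨y, rfl⟩, rfl⟩
  have hmem (z : Fin 4 × Fin 4) : symCoeff a b z ∈ symSpan a b := Submodule.subset_span ⟨z, rfl⟩
  -- Cauchy–Binet for the symmetric matrix `a bᵀ + b aᵀ`, which factors through two dimensions.
  have key : altCoeff a b (pair x) * altCoeff a b (pair y) =
      symCoeff a b ((pair x).1, (pair y).2) * symCoeff a b ((pair x).2, (pair y).1) -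
      symCoeff a b ((pair x).1, (pair y).1) * symCoeff a b ((pair x).2, (pair y).2) := by
    funext i
    simp only [Pi.mul_apply, Pi.sub_apply, altCoeff, symCoeff]
    ring
  simp only [SetLike.mem_coe]
  rw [key]
  exact Submodule.sub_mem _ (Submodule.mul_mem_mul (hmem _) (hmem _))
    (Submodule.mul_mem_mul (hmem _) (hmem _))

theorem IsDetDecomposition.three_le_finrank_symSpan (h : IsDetDecomposition a b c d)
    (h2 : (2 : K) ≠ 0) : 3 ≤ finrank K (symSpan a b) := by
  by_contra! hlt
  have h6 := finrank_le_finrank_mul_self (altSpan a b)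
  rw [h.swap.finrank_altSpan h2] at h6
  have hmono := Submodule.finrank_mono (altSpan_mul_altSpan_le a b)
  have h3 := finrank_mul_self_le_three (symSpan a b) (by omega)
  omega

theorem IsDetDecomposition.twelve_le (h : IsDetDecomposition a b c d) (h2 : (2 : K) ≠ 0) :
    12 ≤ k := by
  have hab := h.three_le_finrank_symSpan h2
  have hcd := h.swap.three_le_finrank_symSpan h2
  have := h.finrank_symSpan_add_le h2
  omega

end LowerBound

/-! ### Passage from tensors to coordinates -/

/-- The standard basis of `(Kⁿ)^{⊗ n}`. -/
noncomputable def stdTensorBasis (K : Type*) [Field K] (n : ℕ) :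
    Basis (Fin n → Fin n) K (⨂[K] _ : Fin n, (Fin n → K)) :=
  Basis.piTensorProduct fun _ => Pi.basisFun K (Fin n)

theorem stdTensorBasis_repr_tprod {K : Type*} [Field K] {n : ℕ} (v : Fin n → Fin n → K)
    (p : Fin n → Fin n) :
    (stdTensorBasis K n).repr (PiTensorProduct.tprod K v) p = ∏ j, v j (p j) := by
  simp [stdTensorBasis, Basis.piTensorProduct_repr_tprod_apply]

theorem stdTensorBasis_repr_detTensor (K : Type*) [Field K] (p : Fin 4 → Fin 4) :
    (stdTensorBasis K 4).repr (detTensor K 4) p =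
      (leviCivita (p 0) (p 1) (p 2) (p 3) : K) := by
  rw [← sum_perm_sign_eq_leviCivita, detTensor, map_sum, Finsupp.finsetSum_apply]
  push_cast
  refine Finset.sum_congr rfl fun σ _ => ?_
  rw [map_smul, Finsupp.smul_apply, stdTensorBasis_repr_tprod, smul_eq_mul]
  congr 1
  simp only [Fin.prod_univ_four, Pi.single_apply, ← ite_and, mul_ite, mul_one, mul_zero,
    @eq_comm _ (p _)]
  congr 1
  exact propext (by tauto)

theorem detTensor_eq_sum_tprod_iff {K : Type*} [Field K] {k : ℕ} (v : Fin k → Fin 4 → Fin 4 → K) :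
    detTensor K 4 = ∑ i, PiTensorProduct.tprod K (v i) ↔
      IsDetDecomposition (v · 0) (v · 1) (v · 2) (v · 3) := by
  have hrepr (p : Fin 4 → Fin 4) :
      (stdTensorBasis K 4).repr (∑ i, PiTensorProduct.tprod K (v i)) p =
        ∑ i, v i 0 (p 0) * v i 1 (p 1) * v i 2 (p 2) * v i 3 (p 3) := by
    simp only [map_sum, Finsupp.finsetSum_apply, stdTensorBasis_repr_tprod, Fin.prod_univ_four]
  constructor
  · intro h p q s t
    have := hrepr ![p, q, s, t]
    rw [← h, stdTensorBasis_repr_detTensor] at this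
    exact this.symm
  · intro h
    refine (stdTensorBasis K 4).ext_elem fun p => ?_
    rw [hrepr, stdTensorBasis_repr_detTensor]
    exact (h _ _ _ _).symm

/-! ### A decomposition with twelve terms -/

/-- The integral vectors `e i + e j` (for `s = 1`) and `e i - e j` (for `s = -1`), where
`x = (i, j)`. -/
def pairVector (s : ℤ) (x : Fin 4 × Fin 4) (p : Fin 4) : ℤ :=
  (if p = x.1 then 1 else 0) + s * (if p = x.2 then 1 else 0)

/-- With `W = e i ⊗ e j - e j ⊗ e i` and `S = e i ⊗ e i - e j ⊗ e j` one has
`(e i ∓ e j) ⊗ (e i ± e j) = S ± W`, and the contributions of `S` cancel. -/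
theorem sum_pairVector_eq_two_mul_leviCivita (p q s t : Fin 4) :
    ∑ x : Fin 6, (pairSign x * pairVector (-1) (pair x) p * pairVector 1 (pair x) q *
        pairVector (-1) (pair x.rev) s * pairVector 1 (pair x.rev) t +
      pairSign x * pairVector 1 (pair x) p * pairVector (-1) (pair x) q *
        pairVector 1 (pair x.rev) s * pairVector (-1) (pair x.rev) t) =
      2 * leviCivita p q s t := by
  revert p q s t; decide +kernel

theorem exists_isDetDecomposition_twelve {K : Type*} [Field K] (h2 : (2 : K) ≠ 0) :
    ∃ v : Fin 12 → Fin 4 → Fin 4 → K,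
      IsDetDecomposition (v · 0) (v · 1) (v · 2) (v · 3) := by
  let e : Fin 6 ⊕ Fin 6 ≃ Fin 12 := finSumFinEquiv
  -- The values `ε = 1` and `ε = -1` give the two summands of
  -- `sum_pairVector_eq_two_mul_leviCivita`; `2⁻¹` removes its factor 2.
  let V (ε : ℤ) (x : Fin 6) : Fin 4 → Fin 4 → K :=
    ![fun p => 2⁻¹ * (pairSign x * pairVector (-ε) (pair x) p : ℤ),
      fun p => (pairVector ε (pair x) p : ℤ),
      fun p => (pairVector (-ε) (pair x.rev) p : ℤ),
      fun p => (pairVector ε (pair x.rev) p : ℤ)]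
  refine ⟨fun i => Sum.elim (V 1) (V (-1)) (e.symm i), fun p q s t => ?_⟩
  rw [← e.sum_comp]
  simp only [Equiv.symm_apply_apply, Fintype.sum_sum_type, Sum.elim_inl, Sum.elim_inr]
  have key := congrArg (Int.cast (R := K)) (sum_pairVector_eq_two_mul_leviCivita p q s t)
  rw [← Finset.sum_add_distrib]
  apply mul_left_cancel₀ h2
  rw [← Int.cast_ofNat, ← Int.cast_mul, ← key, Finset.mul_sum, Int.cast_sum]
  refine Finset.sum_congr rfl fun x _ => ?_
  simp [V]
  field_simp

theorem theorem4p4 (K : Type*) [Field K] (hK : ringChar K ≠ 2) :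
    tensorRank K (detTensor K 4) = 12 := by
  have h2 : (2 : K) ≠ 0 := Ring.two_ne_zero hK
  obtain ⟨v, hv⟩ := exists_isDetDecomposition_twelve h2
  refine le_antisymm (Nat.sInf_le ⟨v, (detTensor_eq_sum_tprod_iff v).2 hv⟩) ?_
  refine le_csInf ⟨12, v, (detTensor_eq_sum_tprod_iff v).2 hv⟩ ?_
  rintro k ⟨w, hw⟩
  exact ((detTensor_eq_sum_tprod_iff w).1 hw).twelve_le h2
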